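/- Let $u_2^*:\mathbb R\to(0,\infty)$ be the (rescaled) Hastings–McLeod solution, i.e. the positive, monotonically decreasing solution on $\mathbb R$ of the second Painlevé equation $u''=\xi u+u^3$ with $u(\xi)\to 0$ as $\xi\to+\infty$ and $u(\xi)\sim\sqrt{-\xi}$ as $\xi\to-\infty$ (equivalently $u_2^*=\sqrt2\,w_{\mathrm{HM}}$, where $w_{\mathrm{HM}}''=\xi w_{\mathrm{HM}}+2w_{\mathrm{HM}}^3$). Consider the variational equation along $u_2^*$, $$W'=A(\xi)W,\qquad A(\xi)=\begin{pmatrix}0&1\\ \xi+3u_2^*(\xi)^2&0\end{pmatrix},\qquad W(\xi)\in\mathbb R^2 ,$$ which is the first-order form of $w''=(\xi+3(u_2^*)^2)w$. For $\xi_0\in\mathbb R$ let $E^{\mathrm u,-}(\xi_0)\subset\mathbb R^2$ be the unstable subspace at $-\infty$, that is, the set of values $W(\xi_0)$ of solutions $W$ that decay exponentially as $\xi\to-\infty$, and let $E^{\mathrm s,+}(\xi_0)\subset\mathbb R^2$ be the stable subspace at $+\infty$, that is, the set of values $W(\xi_0)$ of solutions $W$ that decay exponentially as $\xi\to+\infty$.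 Then: 1. For every $\xi_0\in\mathbb R$ (in particular $\xi_0=0$) both subspaces are one-dimensional and they intersect transversely: $E^{\mathrm u,-}(\xi_0)\cap E^{\mathrm s,+}(\xi_0)=\{0\}$ and $E^{\mathrm u,-}(\xi_0)+E^{\mathrm s,+}(\xi_0)=\mathbb R^2$, i.e. $\mathbb R^2=E^{\mathrm u,-}(\xi_0)\oplus E^{\mathrm s,+}(\xi_0)$. 2. The linearized Painlevé II operator $L_0w=w''-(\xi+3(u_2^*)^2)w$ has no nontrivial localized kernel: if $w\in C^2(\mathbb R)$ satisfies $L_0w=0$ and $w$ is exponentially localized ($|w(\xi)|\le Ce^{-\alpha|\xi|}$ on $\mathbb R$ for some $C$ and some $\alpha>0$), then $w=0$; likewise, if $w\in C^2(\mathbb R)\cap L^2(\mathbb R)$ satisfies $L_0w=0$, then $w=0$. -/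

import Mathlib

open Filter Topology Asymptotics MeasureTheory

/-- `u` is the Hastings-McLeod solution, in the scaling `u = √2 w` where `w'' = ξ w + 2 w³`:
the positive, monotonically decreasing solution on all of `ℝ` of the second Painlevé equation
`u'' = ξ u + u³` that tends to `0` at `+∞` and is asymptotic to `√(-ξ)` at `-∞`. -/
structure IsHastingsMcLeod (u : ℝ → ℝ) : Prop where
  contDiff : ContDiff ℝ 2 u
  painleve : ∀ ξ : ℝ, deriv (deriv u) ξ = ξ * u ξ + u ξ ^ 3
  pos : ∀ ξ : ℝ, 0 < u ξ
  antitone : Antitone u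
  tendsto_atTop : Tendsto u atTop (𝓝 0)
  isEquivalent_atBot : IsEquivalent atBot u (fun ξ : ℝ => √(-ξ))

/-- The coefficient matrix of the variational equation of `u' = v`, `v' = ξ u + u³` along `u`. -/
def variationalMatrix (u : ℝ → ℝ) (ξ : ℝ) : Matrix (Fin 2) (Fin 2) ℝ :=
  !![0, 1; ξ + 3 * u ξ ^ 2, 0]

/-- `W` solves the variational equation `W' = A(ξ) W` on all of `ℝ`. -/
def IsVariationalSolution (u : ℝ → ℝ) (W : ℝ → Fin 2 → ℝ) : Prop :=
  ∀ ξ : ℝ, HasDerivAt W (Matrix.mulVec (variationalMatrix u ξ) (W ξ)) ξ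

theorem IsVariationalSolution.zero (u : ℝ → ℝ) : IsVariationalSolution u 0 := by
  intro ξ
  simp

theorem IsVariationalSolution.add {u : ℝ → ℝ} {V W : ℝ → Fin 2 → ℝ}
    (hV : IsVariationalSolution u V) (hW : IsVariationalSolution u W) :
    IsVariationalSolution u (V + W) := by
  intro ξ
  simpa [Matrix.mulVec_add] using (hV ξ).add (hW ξ)

theorem IsVariationalSolution.smul {u : ℝ → ℝ} {W : ℝ → Fin 2 → ℝ} (c : ℝ)
    (hW : IsVariationalSolution u W) : IsVariationalSolution u (c • W) := by
  intro ξ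
  simpa [Matrix.mulVec_smul] using (hW ξ).const_smul c

/-- Exponential decay as `ξ → +∞`. -/
def ExpDecayAtTop (W : ℝ → Fin 2 → ℝ) : Prop :=
  ∃ α : ℝ, 0 < α ∧ W =O[atTop] (fun ξ : ℝ => Real.exp (-α * ξ))

/-- Exponential decay as `ξ → -∞`. -/
def ExpDecayAtBot (W : ℝ → Fin 2 → ℝ) : Prop :=
  ∃ α : ℝ, 0 < α ∧ W =O[atBot] (fun ξ : ℝ => Real.exp (α * ξ))

theorem isBigO_exp_atTop_of_le {α β : ℝ} (h : α ≤ β) :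
    (fun ξ : ℝ => Real.exp (-β * ξ)) =O[atTop] (fun ξ : ℝ => Real.exp (-α * ξ)) := by
  refine IsBigO.of_bound 1 ?_
  filter_upwards [eventually_ge_atTop (0 : ℝ)] with ξ hξ
  rw [one_mul, Real.norm_of_nonneg (Real.exp_pos _).le, Real.norm_of_nonneg (Real.exp_pos _).le]
  exact Real.exp_le_exp.mpr (by nlinarith)

theorem isBigO_exp_atBot_of_le {α β : ℝ} (h : α ≤ β) :
    (fun ξ : ℝ => Real.exp (β * ξ)) =O[atBot] (fun ξ : ℝ => Real.exp (α * ξ)) := by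
  refine IsBigO.of_bound 1 ?_
  filter_upwards [eventually_le_atBot (0 : ℝ)] with ξ hξ
  rw [one_mul, Real.norm_of_nonneg (Real.exp_pos _).le, Real.norm_of_nonneg (Real.exp_pos _).le]
  exact Real.exp_le_exp.mpr (by nlinarith)

theorem ExpDecayAtTop.add {V W : ℝ → Fin 2 → ℝ} (hV : ExpDecayAtTop V) (hW : ExpDecayAtTop W) :
    ExpDecayAtTop (V + W) := by
  obtain ⟨α, hα, hV⟩ := hV
  obtain ⟨β, hβ, hW⟩ := hW
  exact ⟨min α β, lt_min hα hβ, (hV.trans (isBigO_exp_atTop_of_le (min_le_left _ _))).add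
    (hW.trans (isBigO_exp_atTop_of_le (min_le_right _ _)))⟩

theorem ExpDecayAtBot.add {V W : ℝ → Fin 2 → ℝ} (hV : ExpDecayAtBot V) (hW : ExpDecayAtBot W) :
    ExpDecayAtBot (V + W) := by
  obtain ⟨α, hα, hV⟩ := hV
  obtain ⟨β, hβ, hW⟩ := hW
  exact ⟨min α β, lt_min hα hβ, (hV.trans (isBigO_exp_atBot_of_le (min_le_left _ _))).add
    (hW.trans (isBigO_exp_atBot_of_le (min_le_right _ _)))⟩

/-- The stable subspace at `+∞`, based at `ξ₀`: the values at `ξ₀` of the solutions of the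
variational equation along `u` that decay exponentially as `ξ → +∞`. -/
def stableSubspace (u : ℝ → ℝ) (ξ₀ : ℝ) : Submodule ℝ (Fin 2 → ℝ) where
  carrier := {a | ∃ W : ℝ → Fin 2 → ℝ, IsVariationalSolution u W ∧ ExpDecayAtTop W ∧ W ξ₀ = a}
  zero_mem' := ⟨0, .zero u, ⟨1, one_pos, isBigO_zero _ _⟩, rfl⟩
  add_mem' := by
    rintro a b ⟨V, hV, hVd, rfl⟩ ⟨W, hW, hWd, rfl⟩
    exact ⟨V + W, hV.add hW, hVd.add hWd, rfl⟩
  smul_mem' := by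
    rintro c a ⟨W, hW, ⟨α, hα, hd⟩, rfl⟩
    exact ⟨c • W, hW.smul c, ⟨α, hα, hd.const_smul_left c⟩, rfl⟩

/-- The unstable subspace at `-∞`, based at `ξ₀`: the values at `ξ₀` of the solutions of the
variational equation along `u` that decay exponentially as `ξ → -∞`. -/
def unstableSubspace (u : ℝ → ℝ) (ξ₀ : ℝ) : Submodule ℝ (Fin 2 → ℝ) where
  carrier := {a | ∃ W : ℝ → Fin 2 → ℝ, IsVariationalSolution u W ∧ ExpDecayAtBot W ∧ W ξ₀ = a}
  zero_mem' := ⟨0, .zero u, ⟨1, one_pos, isBigO_zero _ _⟩, rfl⟩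
  add_mem' := by
    rintro a b ⟨V, hV, hVd, rfl⟩ ⟨W, hW, hWd, rfl⟩
    exact ⟨V + W, hV.add hW, hVd.add hWd, rfl⟩
  smul_mem' := by
    rintro c a ⟨W, hW, ⟨α, hα, hd⟩, rfl⟩
    exact ⟨c • W, hW.smul c, ⟨α, hα, hd.const_smul_left c⟩, rfl⟩

/-- The linearized Painlevé II operator `L₀ w = w'' - (ξ + 3u²) w` along `u`
(applied to twice differentiable `w`). -/
noncomputable def linearizedPainleve (u w : ℝ → ℝ) (ξ : ℝ) : ℝ :=
  deriv (deriv w) ξ - (ξ + 3 * u ξ ^ 2) * w ξ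

/-- Exponential localization: `|w ξ| ≤ C exp (-α |ξ|)` on `ℝ` for some `α > 0` and `C`. -/
def ExpLocalized (w : ℝ → ℝ) : Prop :=
  ∃ α : ℝ, 0 < α ∧ ∃ C : ℝ, ∀ ξ : ℝ, |w ξ| ≤ C * Real.exp (-α * |ξ|)

/-!
Write `Q = ξ + 3 u²`, so that the variational equation is `w'' = Q w`. Since `u² ∼ -ξ` at `-∞`,
`Q ≥ 1` near both ends of the line.

*One decaying solution at each end.* Picard's series gives global solutions of linear equations
(`exists_linearODE_solution`). Near `+∞`, reduction of order turns an exponentially growing solution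
into an exponentially decaying one (`exists_isSchrodingerSolution_decay`), and reflection gives the
same at `-∞`. Hence neither subspace is trivial.

*No solution is localized at both ends.* Where `Q ≥ 0` the square of a solution `w` is convex; if it
is bounded or integrable at an end, it is monotone there, so `w w' ≤ 0` near `+∞` and `w w' ≥ 0`
near `-∞`. The Hastings–McLeod solution itself is a positive solution of `y'' = (ξ + u²) y`, whose
potential is smaller than `Q`. Put `P = w' u - w u'` and `B = w w' - w² u' / u = w P / u`. Then
`B' = (P / u)² + 2 u² w² ≥ 0`, and `B ≥ 0` near `-∞` because `u' ≤ 0`; so `B ≥ 0` everywhere. If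
`B` were positive at some point, it would be so from there on, and `(P²)' = 4 u⁴ B` would keep `P²`
away from `0`; but `w w' ≤ 0` gives `P² ≤ w² u'²` near `+∞`, with `w²` bounded and `u'` arbitrarily
small at some large times. So `B = 0`, and `B' = 0` yields `w = 0`
(`IsHastingsMcLeod.eq_zero_of_mul_deriv_sign`).

The two subspaces therefore meet only in `0` and are nonzero, and since the phase space is a plane,
both are lines and they span it.
-/

/-! ### Linear differential equations with continuous coefficients -/

section LinearODE

variable {E : Type*} [NormedAddCommGroup E] [NormedSpace ℝ E]

/-- The `n`-th term of the Picard series of `X' = A(t) X`, `X t₀ = x`: each term is the integral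
from `t₀` of `A` applied to the preceding one, and the sum of the series is the solution. -/
noncomputable def picardTerm (A : ℝ → E →L[ℝ] E) (t₀ : ℝ) (x : E) : ℕ → ℝ → E
  | 0 => fun _ => x
  | n + 1 => fun t => ∫ s in t₀..t, A s (picardTerm A t₀ x n s)

theorem continuous_picardTerm [CompleteSpace E] {A : ℝ → E →L[ℝ] E} (hA : Continuous A) (t₀ : ℝ)
    (x : E) (n : ℕ) : Continuous (picardTerm A t₀ x n) := by
  induction n with
  | zero => exact continuous_const
  | succ n ih =>
    exact intervalIntegral.continuous_primitive
      (fun a b => (hA.clm_apply ih).intervalIntegrable a b) t₀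

theorem hasDerivAt_picardTerm_succ [CompleteSpace E] {A : ℝ → E →L[ℝ] E} (hA : Continuous A)
    (t₀ : ℝ) (x : E) (n : ℕ) (t : ℝ) :
    HasDerivAt (picardTerm A t₀ x (n + 1)) (A t (picardTerm A t₀ x n t)) t :=
  (hA.clm_apply (continuous_picardTerm hA t₀ x n)).integral_hasStrictDerivAt t₀ t |>.hasDerivAt

theorem norm_picardTerm_le {A : ℝ → E →L[ℝ] E} {t₀ T K : ℝ}
    (hK : ∀ t, |t - t₀| ≤ T → ‖A t‖ ≤ K) (hK0 : 0 ≤ K) (x : E) (n : ℕ) :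
    ∀ t, |t - t₀| ≤ T →
      ‖picardTerm A t₀ x n t‖ ≤ K ^ n * ‖x‖ * |t - t₀| ^ n / (n.factorial : ℝ) := by
  induction n with
  | zero => intro t _; simp [picardTerm]
  | succ n ih =>
    intro t ht
    have hsub : ∀ s ∈ Set.uIoc t₀ t, |s - t₀| ≤ T := by
      intro s hs
      have := Set.abs_sub_left_of_mem_uIcc (Set.uIoc_subset_uIcc hs)
      exact this.trans ht
    have hint : IntegrableOn
        (fun s => K ^ (n + 1) * ‖x‖ / (n.factorial : ℝ) * |s - t₀| ^ n) (Set.uIoc t₀ t) :=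
      (Continuous.integrableOn_uIoc (by fun_prop))
    calc ‖picardTerm A t₀ x (n + 1) t‖
        = ‖∫ s in Set.uIoc t₀ t, A s (picardTerm A t₀ x n s)‖ :=
          intervalIntegral.norm_intervalIntegral_eq _ _ _ _
      _ ≤ ∫ s in Set.uIoc t₀ t, K ^ (n + 1) * ‖x‖ / (n.factorial : ℝ) * |s - t₀| ^ n := by
          refine norm_integral_le_of_norm_le hint ?_
          refine (ae_restrict_iff' measurableSet_uIoc).2 (Eventually.of_forall fun s hs => ?_)
          calc ‖A s (picardTerm A t₀ x n s)‖ ≤ ‖A s‖ * ‖picardTerm A t₀ x n s‖ :=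
                (A s).le_opNorm _
            _ ≤ K * (K ^ n * ‖x‖ * |s - t₀| ^ n / (n.factorial : ℝ)) := by
                gcongr
                · exact hK s (hsub s hs)
                · exact ih s (hsub s hs)
            _ = _ := by ring
      _ = K ^ (n + 1) * ‖x‖ * |t - t₀| ^ (n + 1) / ((n + 1).factorial : ℝ) := by
          rw [integral_const_mul, integral_pow_abs_sub_uIoc, Nat.factorial_succ]
          push_cast
          field_simp

theorem exists_norm_le_of_continuous {A : ℝ → E →L[ℝ] E} (hA : Continuous A) (t₀ T : ℝ) :
    ∃ K : ℝ, 0 ≤ K ∧ ∀ t, |t - t₀| ≤ T → ‖A t‖ ≤ K := by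
  obtain ⟨K, hK⟩ := (isCompact_closedBall t₀ T).exists_bound_of_continuousOn hA.continuousOn
  refine ⟨max K 0, le_max_right _ _, fun t ht => (hK t ?_).trans (le_max_left _ _)⟩
  rwa [Metric.mem_closedBall, Real.dist_eq]

/-- A linear differential equation with continuous coefficients has solutions on all of `ℝ`:
the Picard series and its derivative converge uniformly on bounded intervals. -/
theorem exists_linearODE_solution [CompleteSpace E] {A : ℝ → E →L[ℝ] E} (hA : Continuous A)
    (t₀ : ℝ) (x : E) : ∃ X : ℝ → E, X t₀ = x ∧ ∀ t, HasDerivAt X (A t (X t)) t := by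
  have hsum : ∀ T, 0 ≤ T → ∃ K : ℝ, 0 ≤ K ∧ (∀ t, |t - t₀| ≤ T → ‖A t‖ ≤ K) ∧
      Summable (fun n : ℕ => ‖x‖ * ((K * T) ^ n / (n.factorial : ℝ))) ∧
      ∀ n t, |t - t₀| ≤ T →
        ‖picardTerm A t₀ x n t‖ ≤ ‖x‖ * ((K * T) ^ n / (n.factorial : ℝ)) := by
    intro T hT
    obtain ⟨K, hK0, hK⟩ := exists_norm_le_of_continuous hA t₀ T
    refine ⟨K, hK0, hK, (Real.summable_pow_div_factorial _).mul_left _, fun n t ht => ?_⟩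
    refine (norm_picardTerm_le hK hK0 x n t ht).trans ?_
    calc K ^ n * ‖x‖ * |t - t₀| ^ n / (n.factorial : ℝ)
        ≤ K ^ n * ‖x‖ * T ^ n / (n.factorial : ℝ) := by gcongr
      _ = _ := by rw [mul_pow]; ring
  have hsummable : ∀ t, Summable (fun n => picardTerm A t₀ x n t) := by
    intro t
    obtain ⟨K, -, -, hs, hb⟩ := hsum |t - t₀| (abs_nonneg _)
    exact Summable.of_norm_bounded hs fun n => hb n t le_rfl
  refine ⟨fun t => ∑' n, picardTerm A t₀ x n t, ?_, fun t => ?_⟩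
  · change ∑' n, picardTerm A t₀ x n t₀ = x
    rw [tsum_eq_single 0]
    · rfl
    · intro n hn
      obtain ⟨m, rfl⟩ := Nat.exists_eq_succ_of_ne_zero hn
      exact intervalIntegral.integral_same
  · set T := |t - t₀| + 1
    obtain ⟨K, hK0, hK, hs, hb⟩ := hsum T (by positivity)
    have hder : HasDerivAt (fun t => ∑' n, picardTerm A t₀ x (n + 1) t)
        (∑' n, A t (picardTerm A t₀ x n t)) t := by
      refine hasDerivAt_tsum_of_isPreconnected (t := Metric.ball t₀ T) (y₀ := t) (hs.mul_left K)
        Metric.isOpen_ball (convex_ball t₀ T).isPreconnected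
        (fun n y _ => hasDerivAt_picardTerm_succ hA t₀ x n y) (fun n y hy => ?_) ?_
        ((summable_nat_add_iff 1).2 (hsummable t)) ?_
      · have hy' : |y - t₀| ≤ T := by
          rw [Metric.mem_ball, Real.dist_eq] at hy
          exact hy.le
        exact ((A y).le_opNorm _).trans
          (mul_le_mul (hK y hy') (hb n y hy') (norm_nonneg _) hK0)
      all_goals
        rw [Metric.mem_ball, Real.dist_eq]
        linarith
    have heq : (fun t => ∑' n, picardTerm A t₀ x n t) =
        fun t => x + ∑' n, picardTerm A t₀ x (n + 1) t := by
      funext s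
      exact (hsummable s).tsum_eq_zero_add
    rw [← (A t).map_tsum (hsummable t)] at hder
    rw [heq]
    have key := hder.const_add x
    rw [(hsummable t).tsum_eq_zero_add] at key
    exact key

/-- Solutions of a linear differential equation with continuous coefficients are unique. Mathlib's
global uniqueness theorem asks for one Lipschitz constant valid at all times, so the comparison is
made on bounded intervals. -/
theorem linearODE_solution_unique {A : ℝ → E →L[ℝ] E} (hA : Continuous A) {t₀ : ℝ} {X Y : ℝ → E}
    (hX : ∀ t, HasDerivAt X (A t (X t)) t) (hY : ∀ t, HasDerivAt Y (A t (Y t)) t)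
    (h : X t₀ = Y t₀) : X = Y := by
  funext t
  obtain ⟨K, hK0, hK⟩ := exists_norm_le_of_continuous hA t₀ (|t - t₀| + 1)
  have hmem : ∀ s, |s - t₀| ≤ |t - t₀| →
      s ∈ Set.Ioo (t₀ - (|t - t₀| + 1)) (t₀ + (|t - t₀| + 1)) := by
    intro s hs
    have := abs_le.1 hs
    constructor <;> linarith
  refine ODE_solution_unique_of_mem_Ioo (v := fun s y => A s y) (s := fun _ => Set.univ)
    (K := ⟨K, hK0⟩) (fun s hs => ?_) (hmem t₀ (by simp)) (fun s _ => ⟨hX s, trivial⟩)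
    (fun s _ => ⟨hY s, trivial⟩) h (hmem t le_rfl)
  refine ((A s).lipschitz.weaken ?_).lipschitzOnWith
  refine hK s (abs_le.2 ⟨?_, ?_⟩) <;> linarith [hs.1, hs.2]

end LinearODE

/-! ### The scalar equation `w'' = Q w` -/

/-- `w` solves `w'' = Q w` on `ℝ`, with derivative `w'`. -/
def IsSchrodingerSolution (Q w w' : ℝ → ℝ) : Prop :=
  ∀ t, HasDerivAt w (w' t) t ∧ HasDerivAt w' (Q t * w t) t

/-- The coefficient `(x, y) ↦ (y, Q x)` of the first-order form of `w'' = Q w` on `ℝ × ℝ`. -/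
noncomputable def schrodingerCoeff (Q : ℝ → ℝ) (t : ℝ) : (ℝ × ℝ) →L[ℝ] (ℝ × ℝ) :=
  ContinuousLinearMap.inl ℝ ℝ ℝ ∘L ContinuousLinearMap.snd ℝ ℝ ℝ +
    Q t • (ContinuousLinearMap.inr ℝ ℝ ℝ ∘L ContinuousLinearMap.fst ℝ ℝ ℝ)

theorem schrodingerCoeff_apply (Q : ℝ → ℝ) (t : ℝ) (p : ℝ × ℝ) :
    schrodingerCoeff Q t p = (p.2, Q t * p.1) := by
  simp [schrodingerCoeff]

theorem continuous_schrodingerCoeff {Q : ℝ → ℝ} (hQ : Continuous Q) :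
    Continuous (schrodingerCoeff Q) :=
  continuous_const.add (hQ.smul continuous_const)

theorem exists_isSchrodingerSolution {Q : ℝ → ℝ} (hQ : Continuous Q) (t₀ a b : ℝ) :
    ∃ w w' : ℝ → ℝ, IsSchrodingerSolution Q w w' ∧ w t₀ = a ∧ w' t₀ = b := by
  obtain ⟨X, hX0, hX⟩ := exists_linearODE_solution (continuous_schrodingerCoeff hQ) t₀ (a, b)
  simp only [schrodingerCoeff_apply] at hX
  exact ⟨fun t => (X t).1, fun t => (X t).2, fun t =>
    ⟨(hasFDerivAt_fst (𝕜 := ℝ) (p := X t)).comp_hasDerivAt t (hX t),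
      (hasFDerivAt_snd (𝕜 := ℝ) (p := X t)).comp_hasDerivAt t (hX t)⟩, by simp [hX0], by simp [hX0]⟩

theorem IsSchrodingerSolution.eq_of_eq_at {Q : ℝ → ℝ} (hQ : Continuous Q) {v v' w w' : ℝ → ℝ}
    (hv : IsSchrodingerSolution Q v v') (hw : IsSchrodingerSolution Q w w') {t₀ : ℝ}
    (h0 : v t₀ = w t₀) (h1 : v' t₀ = w' t₀) : v = w ∧ v' = w' := by
  have key : (fun t => (v t, v' t)) = fun t => (w t, w' t) := by
    refine linearODE_solution_unique (continuous_schrodingerCoeff hQ) (t₀ := t₀)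
      (fun t => ?_) (fun t => ?_) (by simp only [h0, h1])
    · rw [schrodingerCoeff_apply]
      exact (hv t).1.prodMk (hv t).2
    · rw [schrodingerCoeff_apply]
      exact (hw t).1.prodMk (hw t).2
  exact ⟨funext fun t => congrArg Prod.fst (congrFun key t),
    funext fun t => congrArg Prod.snd (congrFun key t)⟩

theorem IsSchrodingerSolution.comp_neg {Q w w' : ℝ → ℝ} (h : IsSchrodingerSolution Q w w') :
    IsSchrodingerSolution (fun t => Q (-t)) (fun t => w (-t)) (fun t => -w' (-t)) := by
  intro t
  have hn := hasDerivAt_neg t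
  refine ⟨?_, ?_⟩
  · exact ((h (-t)).1.comp t hn).congr_deriv (by ring)
  · exact ((h (-t)).2.comp t hn).neg.congr_deriv (by ring)

theorem monotoneOn_Ici_of_hasDerivAt {f f' : ℝ → ℝ} {R : ℝ}
    (hf : ∀ t, R ≤ t → HasDerivAt f (f' t) t) (hf' : ∀ t, R ≤ t → 0 ≤ f' t) :
    MonotoneOn f (Set.Ici R) := by
  refine monotoneOn_of_hasDerivWithinAt_nonneg (convex_Ici R)
    (HasDerivAt.continuousOn fun t ht => hf t ht) (f' := f') ?_ ?_
  · intro t ht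
    exact (hf t (interior_subset ht)).hasDerivWithinAt
  · intro t ht
    exact hf' t (interior_subset ht)

/-- Where `Q ≥ 0` the square of a solution of `w'' = Q w` is convex, so `w w'` is nondecreasing. -/
theorem IsSchrodingerSolution.monotoneOn_mul {Q w w' : ℝ → ℝ} (h : IsSchrodingerSolution Q w w')
    {R : ℝ} (hQ : ∀ t, R ≤ t → 0 ≤ Q t) : MonotoneOn (fun t => w t * w' t) (Set.Ici R) := by
  refine monotoneOn_Ici_of_hasDerivAt (fun t _ => (h t).1.mul (h t).2) fun t ht => ?_
  nlinarith [mul_nonneg (hQ t ht) (mul_self_nonneg (w t)), mul_self_nonneg (w' t)]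

/-- On a half-line where `Q ≥ 0` the square of a solution is convex, so it lies above its tangents:
once it increases, it can be neither bounded nor integrable. -/
theorem IsSchrodingerSolution.tangent_le_sq {Q w w' : ℝ → ℝ} (h : IsSchrodingerSolution Q w w')
    {R : ℝ} (hQ : ∀ t, R ≤ t → 0 ≤ Q t) {a : ℝ} (ha : R ≤ a) {t : ℝ} (ht : a ≤ t) :
    w a ^ 2 + 2 * (w a * w' a) * (t - a) ≤ w t ^ 2 := by
  have hmono : MonotoneOn (fun t => w t ^ 2 - 2 * (w a * w' a) * (t - a)) (Set.Ici a) := by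
    refine monotoneOn_Ici_of_hasDerivAt (fun s _ => ((h s).1.pow 2).sub
      (((hasDerivAt_id s).sub_const a).const_mul (2 * (w a * w' a)))) fun s hs => ?_
    have := h.monotoneOn_mul hQ (Set.mem_Ici.2 ha) (Set.mem_Ici.2 (ha.trans hs)) hs
    simp only at this
    simp
    linarith
  have := hmono Set.self_mem_Ici (Set.mem_Ici.2 ht) ht
  simp only [sub_self, mul_zero, sub_zero] at this
  linarith

/-- A solution that is bounded at `+∞`, where `Q ≥ 0`, has nonincreasing square there. -/
theorem IsSchrodingerSolution.mul_nonpos_of_bounded {Q w w' : ℝ → ℝ}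
    (h : IsSchrodingerSolution Q w w') {R : ℝ} (hQ : ∀ t, R ≤ t → 0 ≤ Q t) {M : ℝ}
    (hM : ∀ t, R ≤ t → w t ^ 2 ≤ M) {a : ℝ} (ha : R ≤ a) : w a * w' a ≤ 0 := by
  by_contra! hpos
  have hM0 : 0 ≤ M := (sq_nonneg (w R)).trans (hM R le_rfl)
  set c := w a * w' a
  have hta : a ≤ a + M / c := by
    have : 0 ≤ M / c := by positivity
    linarith
  have h1 := h.tangent_le_sq hQ ha hta
  have h2 := hM _ (ha.trans hta)
  have h3 : 2 * c * (a + M / c - a) = 2 * M := by field_simp; ring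
  have h4 : w a ^ 2 ≠ 0 := by
    intro h0
    have : w a = 0 := by simpa using h0
    simp [c, this] at hpos
  have h5 : 0 < w a ^ 2 := lt_of_le_of_ne (sq_nonneg _) (Ne.symm h4)
  change w a ^ 2 + 2 * c * (a + M / c - a) ≤ _ at h1
  linarith

/-- A solution that is square integrable at `+∞`, where `Q ≥ 0`, has nonincreasing square there. -/
theorem IsSchrodingerSolution.mul_nonpos_of_integrableOn {Q w w' : ℝ → ℝ}
    (h : IsSchrodingerSolution Q w w') {R : ℝ} (hQ : ∀ t, R ≤ t → 0 ≤ Q t)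
    (hw : IntegrableOn (fun t => w t ^ 2) (Set.Ici R)) {a : ℝ} (ha : R ≤ a) : w a * w' a ≤ 0 := by
  by_contra! hpos
  have hwa : w a ≠ 0 := by
    rintro h0
    simp [h0] at hpos
  have hint : IntegrableOn (fun _ : ℝ => w a ^ 2) (Set.Ici a) := by
    refine (hw.mono_set (Set.Ici_subset_Ici.2 ha)).mono' aestronglyMeasurable_const ?_
    refine (ae_restrict_iff' measurableSet_Ici).2 (Eventually.of_forall fun t ht => ?_)
    have h1 := h.tangent_le_sq hQ ha (Set.mem_Ici.1 ht)
    have h2 : 0 ≤ 2 * (w a * w' a) * (t - a) :=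
      mul_nonneg (by linarith) (sub_nonneg.2 ht)
    rw [Real.norm_of_nonneg (sq_nonneg _)]
    linarith
  rw [integrableOn_const_iff] at hint
  simp [hwa] at hint

/-! ### Existence of a decaying solution -/

/-- If `Q ≥ 1` on a half-line, the solution with initial data `(1, 1)` grows at least like an
exponential there. The conclusion is phrased through `φ²` and `φ φ'`, whose signs are immediate. -/
theorem IsSchrodingerSolution.growth {Q φ φ' : ℝ → ℝ} (h : IsSchrodingerSolution Q φ φ') {R : ℝ}
    (hQ : ∀ t, R ≤ t → 1 ≤ Q t) (h0 : φ R = 1) (h1 : φ' R = 1) {t : ℝ} (ht : R ≤ t) :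
    Real.exp (2 * (t - R)) ≤ φ t ^ 2 ∧ φ t ^ 2 ≤ φ t * φ' t := by
  have hd : ∀ t, R ≤ t → φ t ^ 2 ≤ φ t * φ' t := by
    have hmono : MonotoneOn (fun t => φ t * φ' t - φ t ^ 2) (Set.Ici R) := by
      refine monotoneOn_Ici_of_hasDerivAt
        (fun s _ => ((h s).1.mul (h s).2).sub ((h s).1.pow 2)) fun s hs => ?_
      simp
      nlinarith [mul_nonneg (sub_nonneg.2 (hQ s hs)) (mul_self_nonneg (φ s)),
        mul_self_nonneg (φ s - φ' s)]
    intro t ht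
    have := hmono Set.self_mem_Ici (Set.mem_Ici.2 ht) ht
    simp only [h0, h1] at this
    linarith
  refine ⟨?_, hd t ht⟩
  have hmono : MonotoneOn (fun t => φ t ^ 2 * Real.exp (-(2 * (t - R)))) (Set.Ici R) := by
    refine monotoneOn_Ici_of_hasDerivAt
      (fun s _ => ((h s).1.pow 2).mul
        ((((hasDerivAt_id s).sub_const R).const_mul 2).neg.exp)) fun s hs => ?_
    have := hd s hs
    have he := Real.exp_pos (-(2 * (s - R)))
    simp
    nlinarith [mul_nonneg (sub_nonneg.2 this) he.le]
  have := hmono Set.self_mem_Ici (Set.mem_Ici.2 ht) ht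
  simp only [h0, sub_self, mul_zero, neg_zero, Real.exp_zero, Real.exp_neg] at this
  rw [← div_eq_mul_inv, le_div_iff₀ (Real.exp_pos _)] at this
  linarith

/-- If `Q ≥ 1` near `+∞`, then `w'' = Q w` has a nonzero solution that decays exponentially at `+∞`
together with its derivative. It is obtained by reduction of order: for a growing solution `φ` and
a second solution `ψ` with `φ ψ' - φ' ψ = 1`, the quotient `ψ / φ` increases to a limit `ℓ`, and
`w = ℓ φ - ψ`. -/
theorem exists_isSchrodingerSolution_decay {Q : ℝ → ℝ} (hQc : Continuous Q) {R : ℝ}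
    (hQ : ∀ t, R ≤ t → 1 ≤ Q t) :
    ∃ w w' : ℝ → ℝ, IsSchrodingerSolution Q w w' ∧ (w R ≠ 0 ∨ w' R ≠ 0) ∧
      ∀ t, R ≤ t → |w t| ≤ Real.exp (-(t - R)) ∧ |w' t| ≤ Real.exp (-(t - R)) := by
  obtain ⟨φ, φ', hφ, hφ0, hφ1⟩ := exists_isSchrodingerSolution hQc R 1 1
  obtain ⟨ψ, ψ', hψ, hψ0, hψ1⟩ := exists_isSchrodingerSolution hQc R 0 1
  have hgrow := fun t ht => hφ.growth hQ hφ0 hφ1 (t := t) ht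
  have hφsq : ∀ t, R ≤ t → 0 < φ t ^ 2 := fun t ht => (Real.exp_pos _).trans_le (hgrow t ht).1
  have hφne : ∀ t, R ≤ t → φ t ≠ 0 := fun t ht h0 => by simpa [h0] using hφsq t ht
  have hW : ∀ t, φ t * ψ' t - φ' t * ψ t = 1 := by
    have hder : ∀ t, HasDerivAt (fun t => φ t * ψ' t - φ' t * ψ t) 0 t := by
      intro t
      refine (((hφ t).1.mul (hψ t).2).sub ((hφ t).2.mul (hψ t).1)).congr_deriv ?_
      ring
    intro t
    have := is_const_of_deriv_eq_zero (fun s => (hder s).differentiableAt)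
      (fun s => (hder s).deriv) t R
    simp only [hφ0, hψ0, hψ1, hφ1] at this
    linarith
  have hg : ∀ t, R ≤ t → HasDerivAt (fun t => ψ t / φ t) (1 / φ t ^ 2) t := by
    intro t ht
    refine ((hψ t).1.div (hφ t).1 (hφne t ht)).congr_deriv ?_
    congr 1
    linarith [hW t]
  have hgmono : MonotoneOn (fun t => ψ t / φ t) (Set.Ici R) :=
    monotoneOn_Ici_of_hasDerivAt hg fun t ht => by positivity
  -- `1 / φ² ≤ φ' / φ³` shows that `ψ / φ + 1 / (2 φ²)` is nonincreasing.
  have hGanti : MonotoneOn (fun t => -(ψ t / φ t) - 1 / 2 * (φ t ^ 2)⁻¹) (Set.Ici R) := by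
    refine monotoneOn_Ici_of_hasDerivAt (fun t ht => (hg t ht).neg.sub
      ((((hφ t).1.pow 2).inv (hφsq t ht).ne').const_mul (1 / 2))) fun t ht => ?_
    have hne := hφne t ht
    have h1 := (hgrow t ht).2
    have : -(1 / φ t ^ 2) - 1 / 2 * (-(((2 : ℕ) : ℝ) * φ t ^ (2 - 1) * φ' t) / (φ t ^ 2) ^ 2)
        = (φ t * φ' t - φ t ^ 2) / (φ t ^ 2) ^ 2 := by
      field_simp
      norm_num
      ring
    have h2 : 0 ≤ (φ t * φ' t - φ t ^ 2) / (φ t ^ 2) ^ 2 :=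
      div_nonneg (sub_nonneg.2 h1) (by positivity)
    rw [← this] at h2
    exact h2
  set ℓ := sSup ((fun t => ψ t / φ t) '' Set.Ici R)
  have hub : ∀ t, R ≤ t → ∀ s, R ≤ s → ψ s / φ s ≤ ψ t / φ t + 1 / 2 * (φ t ^ 2)⁻¹ := by
    intro t ht s hs
    have hm : R ≤ max s t := le_max_of_le_right ht
    have h1 : ψ s / φ s ≤ ψ (max s t) / φ (max s t) :=
      hgmono (Set.mem_Ici.2 hs) (Set.mem_Ici.2 hm) (le_max_left _ _)
    have h2 : -(ψ t / φ t) - 1 / 2 * (φ t ^ 2)⁻¹ ≤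
        -(ψ (max s t) / φ (max s t)) - 1 / 2 * (φ (max s t) ^ 2)⁻¹ :=
      hGanti (Set.mem_Ici.2 ht) (Set.mem_Ici.2 hm) (le_max_right _ _)
    have h3 : 0 < (φ (max s t) ^ 2)⁻¹ := inv_pos.2 (hφsq _ hm)
    linarith
  have hle : ∀ t, R ≤ t → ψ t / φ t ≤ ℓ := by
    intro t ht
    refine le_csSup ⟨ψ R / φ R + 1 / 2 * (φ R ^ 2)⁻¹, ?_⟩ ⟨t, ht, rfl⟩
    rintro _ ⟨s, hs, rfl⟩
    exact hub R le_rfl s hs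
  have hge : ∀ t, R ≤ t → ℓ ≤ ψ t / φ t + 1 / 2 * (φ t ^ 2)⁻¹ := by
    intro t ht
    refine csSup_le ⟨_, R, Set.self_mem_Ici, rfl⟩ ?_
    rintro _ ⟨s, hs, rfl⟩
    exact hub t ht s hs
  have hsol : IsSchrodingerSolution Q (fun t => ℓ * φ t - ψ t) (fun t => ℓ * φ' t - ψ' t) := by
    intro t
    refine ⟨((hφ t).1.const_mul ℓ).sub (hψ t).1,
      (((hφ t).2.const_mul ℓ).sub (hψ t).2).congr_deriv (by ring)⟩
  have hwφ : ∀ t, R ≤ t →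
      0 ≤ φ t * (ℓ * φ t - ψ t) ∧ φ t * (ℓ * φ t - ψ t) ≤ 1 / 2 := by
    intro t ht
    have hne := hφne t ht
    have heq : φ t * (ℓ * φ t - ψ t) = φ t ^ 2 * (ℓ - ψ t / φ t) := by field_simp
    rw [heq]
    refine ⟨mul_nonneg (sq_nonneg _) (sub_nonneg.2 (hle t ht)), ?_⟩
    have h1 : ℓ - ψ t / φ t ≤ 1 / 2 * (φ t ^ 2)⁻¹ := by linarith [hge t ht]
    calc φ t ^ 2 * (ℓ - ψ t / φ t) ≤ φ t ^ 2 * (1 / 2 * (φ t ^ 2)⁻¹) := by gcongr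
      _ = 1 / 2 := by field_simp
  have hbound : ∀ t, R ≤ t → ∀ y, |φ t * y| ≤ 1 → |y| ≤ Real.exp (-(t - R)) := by
    intro t ht y hy
    have h1 : Real.exp (t - R) ≤ |φ t| := by
      refine le_of_sq_le_sq ?_ (abs_nonneg _)
      rw [sq_abs, ← Real.exp_nat_mul]
      exact_mod_cast (hgrow t ht).1
    rw [abs_mul] at hy
    rw [Real.exp_neg, ← one_div, le_div_iff₀ (Real.exp_pos _)]
    nlinarith [abs_nonneg y]
  have hwb : ∀ t, R ≤ t → |ℓ * φ t - ψ t| ≤ Real.exp (-(t - R)) := by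
    intro t ht
    refine hbound t ht _ ?_
    rw [abs_of_nonneg (hwφ t ht).1]
    linarith [(hwφ t ht).2]
  refine ⟨_, _, hsol, ?_, fun t ht => ⟨hwb t ht, hbound t ht _ ?_⟩⟩
  · simp only [hφ0, hψ0, hφ1, hψ1]
    by_contra! hcon
    linarith [hcon.1, hcon.2]
  · -- Boundedness gives `w w' ≤ 0`; since `φ w' = φ' w - 1`, this confines `φ w'` to `[-1, 0]`.
    have hneg := hsol.mul_nonpos_of_bounded (R := R) (M := 1)
      (fun s hs => zero_le_one.trans (hQ s hs)) (fun s hs => ?_) ht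
    · have h1 : φ t * (ℓ * φ' t - ψ' t) = φ' t * (ℓ * φ t - ψ t) - 1 := by linarith [hW t]
      obtain ⟨hw0, hw1⟩ := hwφ t ht
      have hs := hφsq t ht
      have hg2 := (hgrow t ht).2
      have hpp : 0 < φ t * φ' t := hs.trans_le hg2
      rw [abs_le]
      have key : φ t ^ 2 * (φ' t * (ℓ * φ t - ψ t)) =
          (φ t * φ' t) * (φ t * (ℓ * φ t - ψ t)) := by ring
      have hn : 0 ≤ φ' t * (ℓ * φ t - ψ t) := by
        have : 0 ≤ φ t ^ 2 * (φ' t * (ℓ * φ t - ψ t)) := by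
          rw [key]; exact mul_nonneg hpp.le hw0
        exact nonneg_of_mul_nonneg_right this hs
      refine ⟨by linarith, ?_⟩
      rcases hw0.eq_or_lt with h0 | hpos
      · have : ℓ * φ t - ψ t = 0 := by
          rcases mul_eq_zero.1 h0.symm with h | h
          · exact absurd h (hφne t ht)
          · exact h
        rw [h1, this]
        norm_num
      · by_contra! hcon
        have hq : 0 < φ t * (ℓ * φ' t - ψ' t) := by linarith
        have h5 : φ t ^ 2 * ((ℓ * φ t - ψ t) * (ℓ * φ' t - ψ' t)) ≤ 0 :=
          mul_nonpos_of_nonneg_of_nonpos hs.le hneg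
        nlinarith [mul_pos hpos hq]
    · have h6 := hwb s hs
      have h7 : Real.exp (-(s - R)) ≤ 1 := Real.exp_le_one_iff.2 (by linarith)
      rw [← sq_abs]
      exact pow_le_one₀ (abs_nonneg _) (h6.trans h7)

/-! ### The linearization along the Hastings–McLeod solution -/

namespace IsHastingsMcLeod

variable {u : ℝ → ℝ}

theorem hasDerivAt (hu : IsHastingsMcLeod u) (t : ℝ) : HasDerivAt u (deriv u t) t :=
  (hu.contDiff.differentiable (by norm_num) t).hasDerivAt

theorem hasDerivAt_deriv (hu : IsHastingsMcLeod u) (t : ℝ) :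
    HasDerivAt (deriv u) (t * u t + u t ^ 3) t := by
  rw [← hu.painleve t]
  have h : ContDiff ℝ (1 + 1) u := by
    rw [one_add_one_eq_two]
    exact hu.contDiff
  exact ((contDiff_succ_iff_deriv.1 h).2.2.differentiable (by norm_num) t).hasDerivAt

theorem deriv_nonpos (hu : IsHastingsMcLeod u) (t : ℝ) : deriv u t ≤ 0 :=
  hu.antitone.deriv_nonpos

theorem continuous_potential (hu : IsHastingsMcLeod u) :
    Continuous fun t => t + 3 * u t ^ 2 := by
  have := hu.contDiff.continuous
  fun_prop

theorem one_le_potential_of_one_le {t : ℝ} (ht : 1 ≤ t) : 1 ≤ t + 3 * u t ^ 2 := by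
  nlinarith [sq_nonneg (u t)]

/-- At `-∞` the potential `ξ + 3 u²` behaves like `-2 ξ`. -/
theorem exists_one_le_potential (hu : IsHastingsMcLeod u) :
    ∃ R : ℝ, ∀ t, t ≤ R → 1 ≤ t + 3 * u t ^ 2 := by
  have h := hu.isEquivalent_atBot.isLittleO.bound (c := 1 / 10) (by norm_num)
  obtain ⟨R, hR⟩ := eventually_atBot.1 h
  refine ⟨min R (-1), fun t ht => ?_⟩
  have h1 := hR t (ht.trans (min_le_left _ _))
  have ht1 : t ≤ -1 := ht.trans (min_le_right _ _)
  simp only [Pi.sub_apply, Real.norm_eq_abs] at h1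
  have hs := Real.sqrt_nonneg (-t)
  rw [abs_of_nonneg hs] at h1
  have hsq : √(-t) ^ 2 = -t := Real.sq_sqrt (by linarith)
  have h2 : 9 / 10 * √(-t) ≤ u t := by linarith [(abs_le.1 h1).1]
  have h3 : (9 / 10 * √(-t)) ^ 2 ≤ u t ^ 2 := pow_le_pow_left₀ (by positivity) h2 2
  nlinarith

/-- `u'` is nonpositive and cannot stay away from `0`, since `u` is bounded below. -/
theorem exists_neg_lt_deriv (hu : IsHastingsMcLeod u) {ε : ℝ} (hε : 0 < ε) (T : ℝ) :
    ∃ t, T ≤ t ∧ -ε < deriv u t := by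
  by_contra! hcon
  have hmono : MonotoneOn (fun t => -u t - ε * t) (Set.Ici T) := by
    refine monotoneOn_Ici_of_hasDerivAt (fun t _ =>
      (hu.hasDerivAt t).neg.sub ((hasDerivAt_id t).const_mul ε)) fun t ht => ?_
    linarith [hcon t ht]
  have hle : T ≤ T + u T / ε := by
    have := div_pos (hu.pos T) hε
    linarith
  have h1 := hmono Set.self_mem_Ici (Set.mem_Ici.2 hle) hle
  have h2 : ε * (T + u T / ε) = ε * T + u T := by field_simp
  simp only [h2] at h1
  linarith [hu.pos (T + u T / ε)]

/-- A solution `w` of the linearized equation whose square is monotone near both ends, with `w²`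
nondecreasing near `-∞` and nonincreasing near `+∞`, vanishes. The function
`B = w w' - w² u' / u = u² v v'`, where `v = w / u`, is nondecreasing, because `u` is a positive
solution of the equation with the smaller potential `ξ + u²`. -/
theorem eq_zero_of_mul_deriv_sign (hu : IsHastingsMcLeod u) {w w' : ℝ → ℝ}
    (hw : IsSchrodingerSolution (fun t => t + 3 * u t ^ 2) w w') {R R' : ℝ}
    (htop : ∀ t, R ≤ t → w t * w' t ≤ 0) (hbot : ∀ t, t ≤ R' → 0 ≤ w t * w' t) (t : ℝ) :
    w t = 0 := by
  have hpos := hu.pos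
  set B : ℝ → ℝ := fun t => w t * w' t - w t ^ 2 * deriv u t / u t with hB
  set P : ℝ → ℝ := fun t => w' t * u t - w t * deriv u t with hP
  have hBder : ∀ t, HasDerivAt B ((P t / u t) ^ 2 + 2 * u t ^ 2 * w t ^ 2) t := by
    intro t
    refine (((hw t).1.mul (hw t).2).sub ((((hw t).1.pow 2).mul (hu.hasDerivAt_deriv t)).div
      (hu.hasDerivAt t) (hpos t).ne')).congr_deriv ?_
    have := (hpos t).ne'
    simp only [hP, Pi.mul_apply, Pi.pow_apply]
    field_simp
    norm_num
    ring
  have hPder : ∀ t, HasDerivAt P (2 * u t ^ 3 * w t) t := by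
    intro t
    refine (((hw t).2.mul (hu.hasDerivAt t)).sub
      ((hw t).1.mul (hu.hasDerivAt_deriv t))).congr_deriv ?_
    ring
  have hBP : ∀ t, w t * P t = u t * B t := by
    intro t
    have := (hpos t).ne'
    simp only [hP, hB]
    field_simp
  have hBmono : Monotone B :=
    monotone_of_hasDerivAt_nonneg hBder fun t => by have := hpos t; positivity
  have hB0 : ∀ t, 0 ≤ B t := by
    intro t
    refine le_trans ?_ (hBmono (min_le_left t R'))
    set s := min t R'
    have h1 := hbot s (min_le_right _ _)
    have h2 : w s ^ 2 * deriv u s / u s ≤ 0 :=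
      div_nonpos_of_nonpos_of_nonneg
        (mul_nonpos_of_nonneg_of_nonpos (sq_nonneg _) (hu.deriv_nonpos s)) (hpos s).le
    simp only [hB]
    linarith
  have hBzero : ∀ t, B t = 0 := by
    intro a
    by_contra hne
    have hBpos : ∀ t, a ≤ t → 0 < B t := fun t ht =>
      (lt_of_le_of_ne (hB0 a) (Ne.symm hne)).trans_le (hBmono ht)
    have hwne : ∀ t, a ≤ t → w t ≠ 0 := by
      intro t ht h0
      have := hBP t
      rw [h0, zero_mul] at this
      exact (mul_pos (hpos t) (hBpos t ht)).ne this
    have hPa : 0 < P a ^ 2 := by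
      have : P a ≠ 0 := by
        intro h0
        have := hBP a
        rw [h0, mul_zero] at this
        exact (mul_pos (hpos a) (hBpos a le_rfl)).ne this
      positivity
    -- `(P²)' = 4 u³ w P = 4 u⁴ B` keeps `P²` away from `0`.
    have hPmono : MonotoneOn (fun t => P t ^ 2) (Set.Ici a) := by
      refine monotoneOn_Ici_of_hasDerivAt (fun t _ => (hPder t).pow 2) fun t ht => ?_
      have h1 : ((2 : ℕ) : ℝ) * P t ^ (2 - 1) * (2 * u t ^ 3 * w t) =
          4 * u t ^ 3 * (w t * P t) := by
        norm_num
        ring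
      rw [h1, hBP t]
      have := hpos t
      have := (hBpos t ht).le
      positivity
    set T := max a R
    have hwanti : ∀ t, T ≤ t → w t ^ 2 ≤ w T ^ 2 := by
      have hmono : MonotoneOn (fun t => -w t ^ 2) (Set.Ici T) := by
        refine monotoneOn_Ici_of_hasDerivAt (fun t _ => ((hw t).1.pow 2).neg) fun t ht => ?_
        have := htop t ((le_max_right _ _).trans ht)
        norm_num
        nlinarith
      intro t ht
      have := hmono Set.self_mem_Ici (Set.mem_Ici.2 ht) ht
      simp only at this
      linarith
    -- Conversely `w w' ≤ 0` forces `P² ≤ w² u'²`, which is arbitrarily small somewhere.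
    have hPle : ∀ t, T ≤ t → P t ^ 2 ≤ w t ^ 2 * deriv u t ^ 2 := by
      intro t ht
      have hat := (le_max_left a R).trans ht
      have h1 : 0 < w t * P t := by
        rw [hBP t]
        exact mul_pos (hpos t) (hBpos t hat)
      have h2 : w t * P t ≤ -(w t ^ 2 * deriv u t) := by
        have := mul_nonpos_of_nonneg_of_nonpos (hpos t).le (htop t ((le_max_right _ _).trans ht))
        simp only [hP]
        nlinarith
      have h3 : (w t * P t) ^ 2 ≤ (-(w t ^ 2 * deriv u t)) ^ 2 :=
        pow_le_pow_left₀ h1.le h2 2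
      have h4 : 0 < w t ^ 2 := by
        have := hwne t hat
        positivity
      refine le_of_mul_le_mul_left ?_ h4
      linarith [mul_pow (w t) (P t) 2, show (-(w t ^ 2 * deriv u t)) ^ 2 =
        w t ^ 2 * (w t ^ 2 * deriv u t ^ 2) by ring]
    set M := w T ^ 2 + 1
    have hMpos : 0 < M := by positivity
    obtain ⟨t, ht, htu⟩ := hu.exists_neg_lt_deriv
      (ε := min 1 (P a ^ 2 / (2 * M))) (by positivity) T
    set ε := min 1 (P a ^ 2 / (2 * M))
    have hεpos : 0 < ε := by positivity
    have hu0 := hu.deriv_nonpos t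
    have h1 : P a ^ 2 ≤ P t ^ 2 := by
      have hat := (le_max_left a R).trans ht
      exact hPmono Set.self_mem_Ici (Set.mem_Ici.2 hat) hat
    have h2 : deriv u t ^ 2 ≤ ε := by
      have : ε ≤ 1 := min_le_left _ _
      nlinarith
    have h3 : w t ^ 2 * deriv u t ^ 2 ≤ M * ε := by
      have := hwanti t ht
      exact mul_le_mul (by linarith) h2 (sq_nonneg _) hMpos.le
    have h4 : M * ε ≤ P a ^ 2 / 2 := by
      calc M * ε ≤ M * (P a ^ 2 / (2 * M)) := by
            gcongr
            exact min_le_right _ _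
        _ = P a ^ 2 / 2 := by field_simp
    linarith [hPle t ht]
  have hder := hBder t
  rw [show B = fun _ => 0 from funext hBzero] at hder
  have h0 := hder.unique (hasDerivAt_const t (0 : ℝ))
  have h1 : 2 * u t ^ 2 * w t ^ 2 = 0 := by
    have := sq_nonneg (P t / u t)
    have : 0 ≤ 2 * u t ^ 2 * w t ^ 2 := by positivity
    linarith
  have := (hpos t).ne'
  simpa [this] using h1

/-- The linearized equation has no nonzero solution that is bounded near both ends. -/
theorem eq_zero_of_bounded (hu : IsHastingsMcLeod u) {w w' : ℝ → ℝ}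
    (hw : IsSchrodingerSolution (fun t => t + 3 * u t ^ 2) w w') {M M' : ℝ}
    (htop : ∀ᶠ t in atTop, w t ^ 2 ≤ M) (hbot : ∀ᶠ t in atBot, w t ^ 2 ≤ M') (t : ℝ) :
    w t = 0 := by
  obtain ⟨R₀, hR₀⟩ := hu.exists_one_le_potential
  obtain ⟨R₁, hR₁⟩ := eventually_atTop.1 htop
  obtain ⟨R₂, hR₂⟩ := eventually_atBot.1 hbot
  refine hu.eq_zero_of_mul_deriv_sign hw (R := max 1 R₁) (R' := min R₀ R₂)
    (fun s hs => ?_) (fun s hs => ?_) t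
  · refine hw.mul_nonpos_of_bounded (R := max 1 R₁) (M := M) (fun r hr => ?_) (fun r hr => ?_) hs
    · exact zero_le_one.trans (one_le_potential_of_one_le ((le_max_left _ _).trans hr))
    · exact hR₁ r ((le_max_right _ _).trans hr)
  · have := hw.comp_neg.mul_nonpos_of_bounded (R := -min R₀ R₂) (M := M') (a := -s)
      (fun r hr => ?_) (fun r hr => ?_) (by linarith)
    · simp only [neg_neg] at this
      linarith
    · exact zero_le_one.trans (hR₀ (-r) ((neg_le.1 hr).trans (min_le_left _ _)))
    · exact hR₂ (-r) ((neg_le.1 hr).trans (min_le_right _ _))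

/-- The linearized equation has no nonzero square integrable solution. -/
theorem eq_zero_of_integrable_sq (hu : IsHastingsMcLeod u) {w w' : ℝ → ℝ}
    (hw : IsSchrodingerSolution (fun t => t + 3 * u t ^ 2) w w')
    (hint : Integrable fun t => w t ^ 2) (t : ℝ) : w t = 0 := by
  obtain ⟨R₀, hR₀⟩ := hu.exists_one_le_potential
  refine hu.eq_zero_of_mul_deriv_sign hw (R := 1) (R' := R₀) (fun s hs => ?_) (fun s hs => ?_) t
  · exact hw.mul_nonpos_of_integrableOn (R := 1)
      (fun r hr => zero_le_one.trans (one_le_potential_of_one_le hr)) hint.integrableOn hs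
  · have := hw.comp_neg.mul_nonpos_of_integrableOn (R := -R₀) (a := -s)
      (fun r hr => zero_le_one.trans (hR₀ (-r) (neg_le.1 hr))) hint.comp_neg.integrableOn
      (by linarith)
    simp only [neg_neg] at this
    linarith

end IsHastingsMcLeod

/-! ### Stable and unstable subspaces -/

theorem isVariationalSolution_iff {u : ℝ → ℝ} {W : ℝ → Fin 2 → ℝ} :
    IsVariationalSolution u W ↔
      IsSchrodingerSolution (fun t => t + 3 * u t ^ 2) (fun t => W t 0) (fun t => W t 1) := by
  refine forall_congr' fun t => ?_
  rw [hasDerivAt_pi]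
  simp [Fin.forall_fin_two, variationalMatrix, Matrix.mulVec, dotProduct]

theorem ExpDecayAtTop.eventually_sq_le {W : ℝ → Fin 2 → ℝ} (h : ExpDecayAtTop W) :
    ∃ M : ℝ, ∀ᶠ t in atTop, W t 0 ^ 2 ≤ M := by
  obtain ⟨α, hα, hO⟩ := h
  obtain ⟨C, hC, hb⟩ := hO.exists_nonneg
  refine ⟨C ^ 2, ?_⟩
  filter_upwards [hb.bound, eventually_ge_atTop 0] with t ht ht0
  rw [Real.norm_of_nonneg (Real.exp_pos _).le] at ht
  have h1 : Real.exp (-α * t) ≤ 1 := Real.exp_le_one_iff.2 (by nlinarith)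
  have h2 : |W t 0| ≤ C := ((norm_le_pi_norm (W t) 0).trans ht).trans (by nlinarith)
  exact sq_le_sq' (abs_le.1 h2).1 (abs_le.1 h2).2

theorem ExpDecayAtBot.eventually_sq_le {W : ℝ → Fin 2 → ℝ} (h : ExpDecayAtBot W) :
    ∃ M : ℝ, ∀ᶠ t in atBot, W t 0 ^ 2 ≤ M := by
  obtain ⟨α, hα, hO⟩ := h
  have hrefl : ExpDecayAtTop fun t => W (-t) :=
    ⟨α, hα, (hO.comp_tendsto tendsto_neg_atTop_atBot).congr_right fun t => by simp⟩
  obtain ⟨M, hM⟩ := hrefl.eventually_sq_le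
  exact ⟨M, by simpa using tendsto_neg_atBot_atTop.eventually hM⟩

theorem isBigO_exp_of_abs_le {w w' : ℝ → ℝ} {R : ℝ}
    (h : ∀ t, R ≤ t → |w t| ≤ Real.exp (-(t - R)) ∧ |w' t| ≤ Real.exp (-(t - R))) :
    (fun t => ![w t, w' t]) =O[atTop] fun t => Real.exp (-1 * t) := by
  refine IsBigO.of_bound (Real.exp R) ?_
  filter_upwards [eventually_ge_atTop R] with t ht
  have he : Real.exp R * ‖Real.exp (-1 * t)‖ = Real.exp (-(t - R)) := by
    rw [Real.norm_of_nonneg (Real.exp_pos _).le, ← Real.exp_add]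
    ring_nf
  rw [he, pi_norm_le_iff_of_nonneg (Real.exp_pos _).le]
  simpa [Fin.forall_fin_two] using h t ht

namespace IsHastingsMcLeod

variable {u : ℝ → ℝ}

theorem eq_of_isVariationalSolution (hu : IsHastingsMcLeod u) {V W : ℝ → Fin 2 → ℝ}
    (hV : IsVariationalSolution u V) (hW : IsVariationalSolution u W) {ξ₀ : ℝ}
    (h : V ξ₀ = W ξ₀) : V = W := by
  obtain ⟨h0, h1⟩ := (isVariationalSolution_iff.1 hV).eq_of_eq_at hu.continuous_potential
    (isVariationalSolution_iff.1 hW) (t₀ := ξ₀) (by simp only [h]) (by simp only [h])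
  funext t i
  fin_cases i
  · exact congrFun h0 t
  · exact congrFun h1 t

theorem apply_ne_zero_of_isVariationalSolution (hu : IsHastingsMcLeod u) {W : ℝ → Fin 2 → ℝ}
    (hW : IsVariationalSolution u W) {R : ℝ} (h : W R ≠ 0) (ξ₀ : ℝ) : W ξ₀ ≠ 0 := by
  intro h0
  exact h (congrFun (hu.eq_of_isVariationalSolution hW (.zero u) (ξ₀ := ξ₀) h0) R)

theorem stableSubspace_ne_bot (hu : IsHastingsMcLeod u) (ξ₀ : ℝ) : stableSubspace u ξ₀ ≠ ⊥ := by
  obtain ⟨w, w', hw, hne, hdec⟩ := exists_isSchrodingerSolution_decay hu.continuous_potential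
    (R := 1) fun t ht => one_le_potential_of_one_le ht
  have hW : IsVariationalSolution u fun t => ![w t, w' t] := isVariationalSolution_iff.2 hw
  refine (Submodule.ne_bot_iff _).2 ⟨_, ⟨_, hW, ⟨1, one_pos, isBigO_exp_of_abs_le hdec⟩, rfl⟩,
    hu.apply_ne_zero_of_isVariationalSolution hW (R := 1) (fun h0 => ?_) ξ₀⟩
  have e0 : w 1 = 0 := congrFun h0 0
  have e1 : w' 1 = 0 := congrFun h0 1
  exact hne.elim (fun h => h e0) (fun h => h e1)

theorem unstableSubspace_ne_bot (hu : IsHastingsMcLeod u) (ξ₀ : ℝ) :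
    unstableSubspace u ξ₀ ≠ ⊥ := by
  obtain ⟨R, hR⟩ := hu.exists_one_le_potential
  obtain ⟨w, w', hw, hne, hdec⟩ := exists_isSchrodingerSolution_decay
    (hu.continuous_potential.comp continuous_neg) (R := -R) fun t ht => hR (-t) (neg_le.1 ht)
  have hw2 : IsSchrodingerSolution (fun t => t + 3 * u t ^ 2) (fun t => w (-t))
      (fun t => -w' (-t)) := by
    simpa using hw.comp_neg
  have hW : IsVariationalSolution u fun t => ![w (-t), -w' (-t)] :=
    isVariationalSolution_iff.2 hw2
  have hO : (fun t => ![w t, -w' t]) =O[atTop] fun t => Real.exp (-1 * t) :=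
    isBigO_exp_of_abs_le (w' := fun t => -w' t) (by simpa only [abs_neg] using hdec)
  refine (Submodule.ne_bot_iff _).2 ⟨_, ⟨_, hW, ⟨1, one_pos,
    (hO.comp_tendsto tendsto_neg_atBot_atTop).congr_right fun t => by simp⟩, rfl⟩,
    hu.apply_ne_zero_of_isVariationalSolution hW (R := R) (fun h0 => ?_) ξ₀⟩
  have e0 : w (-R) = 0 := congrFun h0 0
  have e1 : -w' (-R) = 0 := congrFun h0 1
  exact hne.elim (fun h => h e0) (fun h => h (neg_eq_zero.1 e1))

theorem unstableSubspace_inf_stableSubspace (hu : IsHastingsMcLeod u) (ξ₀ : ℝ) :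
    unstableSubspace u ξ₀ ⊓ stableSubspace u ξ₀ = ⊥ := by
  refine (Submodule.eq_bot_iff _).2 ?_
  rintro a ⟨⟨V, hV, hVd, rfl⟩, ⟨W, hW, hWd, hWV⟩⟩
  obtain rfl := hu.eq_of_isVariationalSolution hV hW hWV.symm
  obtain ⟨M, hM⟩ := hWd.eventually_sq_le
  obtain ⟨M', hM'⟩ := hVd.eventually_sq_le
  have hsol := isVariationalSolution_iff.1 hV
  have h0 := hu.eq_zero_of_bounded hsol hM hM'
  have h1 : V ξ₀ 1 = 0 := by
    have hd := (hsol ξ₀).1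
    rw [show (fun t => V t 0) = fun _ => 0 from funext h0] at hd
    exact hd.unique (hasDerivAt_const _ _)
  funext i
  fin_cases i
  · exact h0 ξ₀
  · exact h1

theorem isSchrodingerSolution_of_linearizedPainleve_eq_zero {w : ℝ → ℝ} (hw : ContDiff ℝ 2 w)
    (h : ∀ ξ : ℝ, linearizedPainleve u w ξ = 0) :
    IsSchrodingerSolution (fun t => t + 3 * u t ^ 2) w (deriv w) := by
  intro t
  refine ⟨(hw.differentiable (by norm_num) t).hasDerivAt, ?_⟩
  have h2 : ContDiff ℝ (1 + 1) w := by
    rw [one_add_one_eq_two]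
    exact hw
  rw [← sub_eq_zero.1 (h t)]
  exact ((contDiff_succ_iff_deriv.1 h2).2.2.differentiable (by norm_num) t).hasDerivAt

end IsHastingsMcLeod

theorem proposition6p2 (u : ℝ → ℝ) (hu : IsHastingsMcLeod u) :
    (∀ ξ₀ : ℝ,
      Module.finrank ℝ (unstableSubspace u ξ₀) = 1 ∧
      Module.finrank ℝ (stableSubspace u ξ₀) = 1 ∧
      unstableSubspace u ξ₀ ⊓ stableSubspace u ξ₀ = ⊥ ∧
      unstableSubspace u ξ₀ ⊔ stableSubspace u ξ₀ = ⊤) ∧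
    (∀ w : ℝ → ℝ, ContDiff ℝ 2 w → (∀ ξ : ℝ, linearizedPainleve u w ξ = 0) →
      ExpLocalized w → w = 0) ∧
    (∀ w : ℝ → ℝ, ContDiff ℝ 2 w → (∀ ξ : ℝ, linearizedPainleve u w ξ = 0) →
      MemLp w 2 volume → w = 0) := by
  refine ⟨fun ξ₀ => ?_, fun w hw hL hloc => ?_, fun w hw hL hLp => ?_⟩
  · have hinf := hu.unstableSubspace_inf_stableSubspace ξ₀
    have hU := Submodule.one_le_finrank_iff.2 (hu.unstableSubspace_ne_bot ξ₀)
    have hS := Submodule.one_le_finrank_iff.2 (hu.stableSubspace_ne_bot ξ₀)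
    have hadd := Submodule.finrank_sup_add_finrank_inf_eq
      (unstableSubspace u ξ₀) (stableSubspace u ξ₀)
    have hle := Submodule.finrank_le (unstableSubspace u ξ₀ ⊔ stableSubspace u ξ₀)
    have h2 : Module.finrank ℝ (Fin 2 → ℝ) = 2 := by simp
    rw [hinf, finrank_bot] at hadd
    refine ⟨by omega, by omega, hinf, Submodule.eq_top_of_finrank_eq (by omega)⟩
  · obtain ⟨α, hα, C, hC⟩ := hloc
    have hb : ∀ t, w t ^ 2 ≤ C ^ 2 := by
      intro t
      have h1 : Real.exp (-α * |t|) ≤ 1 :=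
        Real.exp_le_one_iff.2 (by nlinarith [mul_nonneg hα.le (abs_nonneg t)])
      have hC0 : 0 ≤ C := by
        have := (abs_nonneg _).trans (hC 0)
        simpa using this
      have h2 : |w t| ≤ C := (hC t).trans (by nlinarith)
      exact sq_le_sq' (abs_le.1 h2).1 (abs_le.1 h2).2
    exact funext (hu.eq_zero_of_bounded
      (IsHastingsMcLeod.isSchrodingerSolution_of_linearizedPainleve_eq_zero hw hL)
      (Eventually.of_forall hb) (Eventually.of_forall hb))
  · exact funext (hu.eq_zero_of_integrable_sq
      (IsHastingsMcLeod.isSchrodingerSolution_of_linearizedPainleve_eq_zero hw hL) hLp.integrable_sq)
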